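/- Let $n$ be a positive integer and let $f\colon\{0,1\}^n\to\{0,1\}$ be a Boolean function. A real polynomial in $X_1,\dots,X_n$ is called multilinear if no variable occurs in it with exponent larger than $1$; $\deg$ of a polynomial is its total degree (the zero polynomial is given degree $0$). Define the following. - $\deg(f)$ is the degree of the unique multilinear $p\in\mathbb{R}[X_1,\dots,X_n]$ with $p(x)=f(x)$ for all $x\in\{0,1\}^n$. - $\mathrm{rdeg}(f)$, the rational degree, is the minimum of $\max(\deg(p),\deg(q))$ over all pairs of multilinear $p,q\in\mathbb{R}[X_1,\dots,X_n]$ such that $q(x)\neq 0$ and $p(x)/q(x)=f(x)$ for all $x\in\{0,1\}^n$. - $\mathrm{sdeg}(f)$, the sign degree, is the minimum of $\deg(p)$ over all multilinear $p\in\mathbb{R}[X_1,\dots,X_n]$ such that, for all $x\in\{0,1\}^n$, $p(x)\neq 0$, and $p(x)<0$ if and only if $f(x)=1$. - $D(f)$, the decision tree complexity, is the minimum depth of a deterministic decision tree that queries single bits of $x$ and outputs $f(x)$ at the leaf reached, for every $x\in\{0,1\}^n$. Then $$\deg(f)\;\le\; D(f)\;\le\; 4\,\mathrm{sdeg}(f)^2\,\mathrm{rdeg}(f)^2\;\le\;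 16\,\mathrm{rdeg}(f)^4 .$$ -/

import Mathlib

namespace BooleanFunction

open MvPolynomial

/-- A Boolean function `{0,1}^n → {0,1}`. -/
abbrev BoolFn (n : ℕ) : Type := (Fin n → Bool) → Bool

/-- The real number `0` or `1` named by a bit. -/
def bit (b : Bool) : ℝ := if b then 1 else 0

/-- The value `p(x)` of a real polynomial at a point `x` of the cube `{0,1}^n`. -/
noncomputable def cubeEval {n : ℕ} (p : MvPolynomial (Fin n) ℝ) (x : Fin n → Bool) : ℝ :=
  MvPolynomial.eval (fun i => bit (x i)) p

/-- A polynomial is multilinear if no variable occurs in it with exponent larger than one. -/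
def IsMultilinear {n : ℕ} (p : MvPolynomial (Fin n) ℝ) : Prop :=
  ∀ i, p.degreeOf i ≤ 1

theorem exists_multilinear {n : ℕ} (g : (Fin n → Bool) → ℝ) :
    ∃ p : MvPolynomial (Fin n) ℝ, IsMultilinear p ∧ ∀ x, cubeEval p x = g x := by
  classical
  refine ⟨∑ a : Fin n → Bool, C (g a) * ∏ j, (if a j then X j else 1 - X j), ?_, ?_⟩
  · intro i
    refine (degreeOf_sum_le i _ _).trans (Finset.sup_le fun a _ => ?_)
    refine (degreeOf_C_mul_le _ i _).trans ((degreeOf_prod_le i _ _).trans ?_)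
    have key : ∀ j, degreeOf i (if a j then X j else 1 - X j : MvPolynomial (Fin n) ℝ)
        ≤ if i = j then 1 else 0 := by
      intro j
      have hX : degreeOf i (X j : MvPolynomial (Fin n) ℝ) = if i = j then 1 else 0 :=
        degreeOf_X i j
      split_ifs with h1 h2 h2
      · simp [h2]
      · simp [hX, h2]
      · refine (degreeOf_sub_le i _ _).trans ?_
        simp [h2]
      · refine (degreeOf_sub_le i _ _).trans ?_
        simp [hX, h2]
    calc _ ≤ ∑ j, (if i = j then 1 else 0) := Finset.sum_le_sum fun j _ => key j
      _ = 1 := by simp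
      _ ≤ 1 := le_rfl
  · intro x
    have hprod : ∀ a : Fin n → Bool,
        (∏ j, (if a j then bit (x j) else 1 - bit (x j))) = if a = x then 1 else 0 := by
      intro a
      split_ifs with h
      · subst h
        refine Finset.prod_eq_one fun j _ => ?_
        cases h : a j <;> simp [bit]
      · obtain ⟨j, hj⟩ := Function.ne_iff.mp h
        refine Finset.prod_eq_zero (Finset.mem_univ j) ?_
        cases h1 : a j <;> cases h2 : x j <;> simp_all [bit]
    simp only [cubeEval, map_sum, map_mul, eval_C, map_prod, apply_ite (eval _), eval_X, map_sub,
      map_one]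
    simp [hprod]
theorem multilinear_ext {n : ℕ} {p q : MvPolynomial (Fin n) ℝ} (hp : IsMultilinear p)
    (hq : IsMultilinear q) (h : ∀ x, cubeEval p x = cubeEval q x) : p = q := by
  classical
  refine sub_eq_zero.mp (eq_zero_of_eval_zero_at_prod_finset (p - q)
    (fun _ => ({0, 1} : Finset ℝ)) (fun i => ?_) (fun y hy => ?_))
  · have h2 : ({0, 1} : Finset ℝ).card = 2 := by simp
    have := (degreeOf_sub_le i p q).trans (max_le (hp i) (hq i))
    omega
  · have hxy : (fun i => bit (decide (y i = 1))) = y := by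
      funext i
      have := hy i
      simp only [Finset.mem_insert, Finset.mem_singleton] at this
      rcases this with h0 | h1 <;> simp [bit, *]
    have := h (fun i => decide (y i = 1))
    simp only [cubeEval, hxy] at this
    simp [this]

/-- Every real function on the cube agrees on the cube with exactly one multilinear polynomial. -/
theorem existsUnique_multilinear {n : ℕ} (g : (Fin n → Bool) → ℝ) :
    ∃! p : MvPolynomial (Fin n) ℝ, IsMultilinear p ∧ ∀ x, cubeEval p x = g x := by
  obtain ⟨p, hp, hpe⟩ := exists_multilinear g
  exact ⟨p, ⟨hp, hpe⟩, fun q hq => multilinear_ext hq.1 hp fun x => by rw [hq.2, hpe]⟩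

/-- The unique multilinear polynomial that agrees with `g` on the cube. -/
noncomputable def multilinearRep {n : ℕ} (g : (Fin n → Bool) → ℝ) : MvPolynomial (Fin n) ℝ :=
  (existsUnique_multilinear g).choose

theorem multilinearRep_spec {n : ℕ} (g : (Fin n → Bool) → ℝ) :
    IsMultilinear (multilinearRep g) ∧ ∀ x, cubeEval (multilinearRep g) x = g x :=
  (existsUnique_multilinear g).choose_spec.1

/-- The degree of a Boolean function: the degree of its unique multilinear representation. -/
noncomputable def deg {n : ℕ} (f : BoolFn n) : ℕ :=
  (multilinearRep fun x => bit (f x)).totalDegree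

/-- `p / q` is a rational representation of `f`. -/
def IsRationalRep {n : ℕ} (f : BoolFn n) (p q : MvPolynomial (Fin n) ℝ) : Prop :=
  IsMultilinear p ∧ IsMultilinear q ∧
    ∀ x, cubeEval q x ≠ 0 ∧ cubeEval p x / cubeEval q x = bit (f x)

/-- The rational degree of `f`: the minimum of `max (deg p) (deg q)` over all rational
representations `p / q` of `f`. -/
noncomputable def rdeg {n : ℕ} (f : BoolFn n) : ℕ :=
  sInf {d | ∃ p q, IsRationalRep f p q ∧ d = max p.totalDegree q.totalDegree}

/-- `p` is a sign representation of `f`. -/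
def IsSignRep {n : ℕ} (f : BoolFn n) (p : MvPolynomial (Fin n) ℝ) : Prop :=
  IsMultilinear p ∧ ∀ x, cubeEval p x ≠ 0 ∧ (cubeEval p x < 0 ↔ f x = true)

/-- The sign degree of `f`: the minimum degree of a sign representation of `f`. -/
noncomputable def sdeg {n : ℕ} (f : BoolFn n) : ℕ :=
  sInf {d | ∃ p, IsSignRep f p ∧ d = p.totalDegree}

/-- Deterministic decision trees that query single bits of an `n`-bit input. -/
inductive DecisionTree (n : ℕ) : Type
  /-- Stop and output `b`. -/
  | leaf (b : Bool) : DecisionTree n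
  /-- Query bit `i`; continue with `t₀` if it is `0` and with `t₁` if it is `1`. -/
  | query (i : Fin n) (t₀ t₁ : DecisionTree n) : DecisionTree n

/-- The output of a decision tree on the input `x`. -/
def DecisionTree.eval {n : ℕ} : DecisionTree n → (Fin n → Bool) → Bool
  | .leaf b, _ => b
  | .query i t₀ t₁, x => if x i then t₁.eval x else t₀.eval x

/-- The depth of a decision tree: the largest number of queries on a path from root to leaf. -/
def DecisionTree.depth {n : ℕ} : DecisionTree n → ℕ
  | .leaf _ => 0
  | .query _ t₀ t₁ => 1 + max t₀.depth t₁.depth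

/-- The decision tree `t` computes `f` exactly on every input. -/
def DecisionTree.Computes {n : ℕ} (t : DecisionTree n) (f : BoolFn n) : Prop :=
  ∀ x, t.eval x = f x

/-- The decision tree complexity of `f`: the minimum depth of a decision tree that computes `f`. -/
noncomputable def D {n : ℕ} (f : BoolFn n) : ℕ :=
  sInf {d | ∃ t : DecisionTree n, t.Computes f ∧ d = t.depth}

/-! The minima above are over nonempty sets, so they are attained. -/

theorem rdeg_attained {n : ℕ} (f : BoolFn n) :
    ∃ p q, IsRationalRep f p q ∧ rdeg f = max p.totalDegree q.totalDegree := by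
  refine Nat.sInf_mem (s := {d | ∃ p q, IsRationalRep f p q ∧ d = _}) ?_
  obtain ⟨p, hp, hpe⟩ := exists_multilinear fun x => bit (f x)
  refine ⟨_, p, 1, ⟨hp, fun i => ?_, fun x => ?_⟩, rfl⟩
  · simp
  · simp [← hpe, cubeEval]

theorem sdeg_attained {n : ℕ} (f : BoolFn n) : ∃ p, IsSignRep f p ∧ sdeg f = p.totalDegree := by
  refine Nat.sInf_mem (s := {d | ∃ p, IsSignRep f p ∧ d = _}) ?_
  obtain ⟨p, hp, hpe⟩ := exists_multilinear fun x => if f x then (-1 : ℝ) else 1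
  refine ⟨_, p, ⟨hp, fun x => ?_⟩, rfl⟩
  rw [hpe]
  cases f x <;> norm_num

theorem exists_computes {n : ℕ} (f : BoolFn n) : ∃ t : DecisionTree n, t.Computes f := by
  suffices H : ∀ (s : Finset (Fin n)) (g : BoolFn n),
      (∀ x y, (∀ i ∈ s, x i = y i) → g x = g y) → ∃ t : DecisionTree n, t.Computes g from
    H Finset.univ f fun x y h => congrArg f (funext fun i => h i (Finset.mem_univ i))
  intro s
  induction s using Finset.induction_on with
  | empty =>
    intro g hg
    exact ⟨.leaf (g fun _ => false), fun x => hg _ _ (by simp)⟩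
  | insert i s _ ih =>
    intro g hg
    have key : ∀ b, ∃ t : DecisionTree n, t.Computes fun x => g (Function.update x i b) := by
      refine fun b => ih _ fun x y h => hg _ _ fun j _ => ?_
      by_cases hji : j = i
      · subst hji; simp
      · have : j ∈ s := by simp_all
        simp [Function.update_of_ne hji, h j this]
    obtain ⟨t₀, h₀⟩ := key false
    obtain ⟨t₁, h₁⟩ := key true
    refine ⟨.query i t₀ t₁, fun x => ?_⟩
    cases hx : x i
    · simp only [DecisionTree.eval, hx, h₀ x]
      simp [← hx]
    · simp only [DecisionTree.eval, hx, h₁ x]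
      simp [← hx]

theorem D_attained {n : ℕ} (f : BoolFn n) :
    ∃ t : DecisionTree n, t.Computes f ∧ D f = t.depth := by
  refine Nat.sInf_mem (s := {d | ∃ t : DecisionTree n, t.Computes f ∧ d = _}) ?_
  obtain ⟨t, ht⟩ := exists_computes f
  exact ⟨_, t, ht, rfl⟩

end BooleanFunction

/-! Let `s` be a sign representation of degree `d` and `p / q` a rational representation of degree
`r`. Then `p` is nonzero exactly where `f = 1`, and `q - p` exactly where `f = 0`.

Take `x` maximizing `|s|`, say with `f x = 0`. On the subcube through `x` spanned by a top-degree
monomial of `p`, `p` is somewhere nonzero (`exists_ne_zero_of_coeff_ne_zero`), so `s` changes sign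
there. Markov's inequality allows at most `2 * d ^ 2` disjoint such blocks (`card_blocks_le`). The
union of a maximal disjoint family meets every top-degree monomial, so querying these at most `2 * d
^ 2 * deg p` variables lowers the degree of `p`. If `f x = 1`, the same works for `q - p`. Repeating
until one of the two is constant costs at most `2 * d ^ 2 * (r ^ 2 + r ^ 2)` queries
(`exists_tree`).

For the outer inequalities, a tree of depth `D` gives a polynomial of degree at most `D`, and `q *
(q - 2 * p)` is a sign representation. -/

namespace BooleanFunction

open MvPolynomial

/-! ### Real functions of bounded degree on the cube -/

/-- The monomial `∏ i ∈ S, x i`, as a function on the cube. -/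
def mono {ι : Type*} (S : Finset ι) (x : ι → Bool) : ℝ := ∏ i ∈ S, bit (x i)

/-- The real functions on the cube that are given by polynomials of degree at most `d`. -/
def degLE (ι : Type*) (d : ℕ) : Submodule ℝ ((ι → Bool) → ℝ) :=
  Submodule.span ℝ (mono '' {S : Finset ι | S.card ≤ d})

section DegLE

variable {ι κ : Type*}

theorem mono_mem_degLE {S : Finset ι} {d : ℕ} (h : S.card ≤ d) : mono S ∈ degLE ι d :=
  Submodule.subset_span ⟨S, h, rfl⟩

theorem degLE_mono {d e : ℕ} (h : d ≤ e) : degLE ι d ≤ degLE ι e :=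
  Submodule.span_mono (Set.image_mono fun _ hS => le_trans hS h)

theorem const_mem_degLE (r : ℝ) (d : ℕ) : (fun _ => r) ∈ degLE ι d := by
  have h : (fun _ => r) = r • mono (∅ : Finset ι) := by
    funext x
    simp [mono]
  rw [h]
  exact Submodule.smul_mem _ _ (mono_mem_degLE (by simp))

theorem bit_mem_degLE (i : ι) : (fun x => bit (x i)) ∈ degLE ι 1 := by
  have h : (fun x => bit (x i)) = mono ({i} : Finset ι) := by
    funext x
    simp [mono]
  rw [h]
  exact mono_mem_degLE (by simp)

theorem apply_mem_degLE (φ : Bool → ℝ) (i : ι) : (fun x => φ (x i)) ∈ degLE ι 1 := by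
  have h : (fun x : ι → Bool => φ (x i)) =
      (fun _ => φ false) + (φ true - φ false) • fun x => bit (x i) := by
    funext x
    cases h : x i <;> simp [bit, h]
  rw [h]
  exact Submodule.add_mem _ (const_mem_degLE _ _) (Submodule.smul_mem _ _ (bit_mem_degLE i))

/-- Bits are idempotent, so the product of two monomials is the monomial of the union. -/
theorem mul_mem_degLE {a b : ℕ} {g h : (ι → Bool) → ℝ} (hg : g ∈ degLE ι a)
    (hh : h ∈ degLE ι b) : g * h ∈ degLE ι (a + b) := by
  classical
  have key : degLE ι a * degLE ι b ≤ degLE ι (a + b) := by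
    rw [degLE, degLE, Submodule.span_mul_span, Submodule.span_le]
    rintro _ ⟨_, ⟨S, hS, rfl⟩, _, ⟨T, hT, rfl⟩, rfl⟩
    have h : mono S * mono T = mono (S ∪ T) := by
      funext x
      have hb : ∀ b, bit b * bit b = bit b := fun b => by cases b <;> simp [bit]
      simp only [mono, Pi.mul_apply]
      rw [← Finset.prod_union_inter, ← Finset.prod_sdiff (Finset.inter_subset_union (s := S)),
        mul_assoc, ← Finset.prod_mul_distrib]
      simp [hb]
    simp only [SetLike.mem_coe, h]
    exact mono_mem_degLE ((Finset.card_union_le _ _).trans (Nat.add_le_add hS hT))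
  exact key (Submodule.mul_mem_mul hg hh)

theorem prod_mem_degLE (S : Finset κ) (g : κ → (ι → Bool) → ℝ) (d : κ → ℕ)
    (h : ∀ j ∈ S, g j ∈ degLE ι (d j)) :
    (fun x => ∏ j ∈ S, g j x) ∈ degLE ι (∑ j ∈ S, d j) := by
  classical
  induction S using Finset.induction_on with
  | empty => simpa using const_mem_degLE 1 0
  | insert j S hj ih =>
    rw [Finset.sum_insert hj]
    simp only [Finset.prod_insert hj]
    exact mul_mem_degLE (h j (by simp)) (ih fun i hi => h i (by simp [hi]))

theorem exists_coeff_of_mem_degLE [Fintype ι] {d : ℕ} {g : (ι → Bool) → ℝ}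
    (hg : g ∈ degLE ι d) :
    ∃ c : Finset ι → ℝ, (∀ S, d < S.card → c S = 0) ∧ ∀ x, g x = ∑ S, c S * mono S x := by
  classical
  induction hg using Submodule.span_induction with
  | mem _ h =>
    obtain ⟨S, hS, rfl⟩ := h
    refine ⟨fun T => if T = S then 1 else 0, fun T hT => if_neg ?_, fun x => by simp⟩
    rintro rfl
    exact absurd hS (by simpa using hT)
  | zero => exact ⟨0, by simp, by simp⟩
  | add _ _ _ _ h₁ h₂ =>
    obtain ⟨c, hc, hc'⟩ := h₁
    obtain ⟨e, he, he'⟩ := h₂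
    exact ⟨c + e, fun S hS => by simp [hc S hS, he S hS], fun x => by
      simp [hc', he', add_mul, Finset.sum_add_distrib]⟩
  | smul r _ _ h =>
    obtain ⟨c, hc, hc'⟩ := h
    exact ⟨r • c, fun S hS => by simp [hc S hS], fun x => by
      simp [hc', mul_assoc, Finset.mul_sum]⟩

theorem sum_mono_mem_degLE [Fintype ι] {d : ℕ} {c : Finset ι → ℝ} {g : Finset ι → (κ → Bool) → ℝ}
    (h : ∀ S, c S ≠ 0 → g S ∈ degLE κ d) : (fun x => ∑ S, c S * g S x) ∈ degLE κ d := by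
  have : (fun x => ∑ S, c S * g S x) = ∑ S, c S • g S := by
    funext x
    simp
  rw [this]
  refine Submodule.sum_mem _ fun S _ => ?_
  by_cases hS : c S = 0
  · simp [hS]
  · exact Submodule.smul_mem _ _ (h S hS)

/-- Substituting for each variable an affine function does not increase the degree. -/
theorem comp_mem_degLE [Fintype ι] {d : ℕ} {g : (ι → Bool) → ℝ} (hg : g ∈ degLE ι d)
    {σ : (κ → Bool) → ι → Bool} (hσ : ∀ j, (fun w => bit (σ w j)) ∈ degLE κ 1) :
    g ∘ σ ∈ degLE κ d := by
  obtain ⟨c, hc, hg⟩ := exists_coeff_of_mem_degLE hg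
  have h : g ∘ σ = fun w => ∑ S, c S * mono S (σ w) := by
    funext w
    simp [hg]
  rw [h]
  refine sum_mono_mem_degLE (g := fun S w => mono S (σ w)) fun S hS => ?_
  have hS' : S.card ≤ d := not_lt.mp fun h => hS (hc S h)
  exact degLE_mono (by simpa using hS') (prod_mem_degLE S _ (fun _ => 1) fun j _ => hσ j)

theorem eq_of_mem_degLE_zero {g : (ι → Bool) → ℝ} (hg : g ∈ degLE ι 0) (x y : ι → Bool) :
    g x = g y := by
  induction hg using Submodule.span_induction with
  | mem _ h =>
    obtain ⟨S, hS, rfl⟩ := h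
    have : S = ∅ := by simpa using hS
    simp [this, mono]
  | zero => rfl
  | add _ _ _ _ h₁ h₂ => simp [h₁, h₂]
  | smul _ _ _ h => simp [h]

/-- Restrictions are kept as functions on the whole cube that ignore the fixed variables, so the
recursion never changes the index type. -/
theorem piecewise_comp_mem_degLE [DecidableEq ι] [Fintype ι] {d : ℕ} {g : (ι → Bool) → ℝ}
    (hg : g ∈ degLE ι d) (U : Finset ι) (y : ι → Bool) :
    (fun x => g (U.piecewise y x)) ∈ degLE ι d := by
  refine comp_mem_degLE (σ := fun x => U.piecewise y x) hg fun j => ?_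
  by_cases hj : j ∈ U
  · simpa [hj] using const_mem_degLE _ _
  · simpa [hj] using bit_mem_degLE j

/-- Fixing a set of variables that meets every monomial of top degree lowers the degree. -/
theorem piecewise_comp_mem_degLE_pred [DecidableEq ι] [Fintype ι] {a : ℕ}
    {c : Finset ι → ℝ} {g : (ι → Bool) → ℝ} (hg : ∀ x, g x = ∑ S, c S * mono S x)
    (hc : ∀ S, a < S.card → c S = 0) (U : Finset ι)
    (hU : ∀ S, c S ≠ 0 → S.card = a → ∃ j ∈ S, j ∈ U) (y : ι → Bool) :
    (fun x => g (U.piecewise y x)) ∈ degLE ι (a - 1) := by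
  simp only [hg]
  refine sum_mono_mem_degLE (g := fun S x => mono S (U.piecewise y x)) fun S hS => ?_
  have hcard : S.card ≤ a := not_lt.mp fun h => hS (hc S h)
  refine degLE_mono ?_ (prod_mem_degLE S _ (fun j => if j ∈ U then 0 else 1) fun j _ => ?_)
  · rw [Finset.sum_ite]
    simp only [Finset.sum_const_zero, zero_add, Finset.sum_const, smul_eq_mul, mul_one]
    rcases hcard.lt_or_eq with h | h
    · exact (Finset.card_filter_le _ _).trans (by omega)
    · obtain ⟨j, hjS, hjU⟩ := hU S hS h
      have : (S.filter (· ∉ U)).card < S.card :=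
        Finset.card_lt_card (Finset.filter_ssubset.mpr ⟨j, hjS, by simpa using hjU⟩)
      omega
  · by_cases hj : j ∈ U
    · simpa [hj] using const_mem_degLE _ _
    · simpa [hj] using bit_mem_degLE j

theorem sum_prod_bool [Fintype ι] [DecidableEq ι] (F : ι → Bool → ℝ) :
    ∑ w : ι → Bool, ∏ i, F i (w i) = ∏ i, (F i true + F i false) := by
  have := Finset.prod_univ_sum (fun _ : ι => (Finset.univ : Finset Bool)) F
  simp only [Fintype.piFinset_univ, Fintype.sum_bool] at this
  exact this.symm

theorem mono_eq_prod_univ [Fintype ι] [DecidableEq ι] (S : Finset ι) (x : ι → Bool) :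
    mono S x = ∏ i, if i ∈ S then bit (x i) else 1 := by
  simp [mono, Finset.prod_ite_mem]

/-- A polynomial with a monomial `M` of top degree does not vanish identically on a subcube
with free variables `M`. -/
theorem exists_ne_zero_of_coeff_ne_zero [Fintype ι] {a : ℕ}
    {c : Finset ι → ℝ} {g : (ι → Bool) → ℝ} (hg : ∀ x, g x = ∑ S, c S * mono S x)
    (hc : ∀ S, a < S.card → c S = 0) {M : Finset ι} (hM : c M ≠ 0) (ha : M.card = a)
    (x : ι → Bool) : ∃ y, (∀ j, j ∉ M → y j = x j) ∧ g y ≠ 0 := by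
  classical
  by_contra! H
  -- Signs on `M` and a point mass at `x` off `M`: the weighted sum is the iterated discrete
  -- derivative along `M`. It kills every monomial not containing `M`, and by top degree only `M`
  -- itself contributes.
  let F : ι → Bool → ℝ := fun i b =>
    if i ∈ M then (if b then 1 else -1) else (if b = x i then 1 else 0)
  have hmono : ∀ S, ∑ w : ι → Bool, (∏ i, F i (w i)) * mono S w =
      ∏ i, if i ∈ M then (if i ∈ S then 1 else 0) else (if i ∈ S then bit (x i) else 1) := by
    intro S
    simp only [mono_eq_prod_univ, ← Finset.prod_mul_distrib]
    rw [sum_prod_bool fun i b => F i b * if i ∈ S then bit b else 1]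
    refine Finset.prod_congr rfl fun i _ => ?_
    cases h : x i <;> by_cases h₁ : i ∈ M <;> by_cases h₂ : i ∈ S <;> simp [F, bit, h, h₁, h₂]
  have h₀ : ∑ w : ι → Bool, (∏ i, F i (w i)) * g w = 0 := by
    refine Finset.sum_eq_zero fun w _ => ?_
    by_cases hw : ∀ j, j ∉ M → w j = x j
    · rw [H w hw, mul_zero]
    · push Not at hw
      obtain ⟨j, hj, hne⟩ := hw
      rw [Finset.prod_eq_zero (Finset.mem_univ j) (by simp [F, hj, hne]), zero_mul]
  have h₁ : ∑ w : ι → Bool, (∏ i, F i (w i)) * g w = c M := by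
    simp only [hg, Finset.mul_sum]
    rw [Finset.sum_comm]
    simp only [mul_left_comm _ (c _), ← Finset.mul_sum, hmono]
    rw [Finset.sum_eq_single M]
    · rw [Finset.prod_eq_one, mul_one]
      intro i _
      by_cases h : i ∈ M <;> simp [h]
    · intro S _ hSM
      by_cases hsub : M ⊆ S
      · have : M.card < S.card := Finset.card_lt_card (hsub.ssubset_of_ne hSM.symm)
        rw [hc S (by omega), zero_mul]
      · obtain ⟨i, hi, hiS⟩ := Finset.not_subset.mp hsub
        rw [Finset.prod_eq_zero (Finset.mem_univ i) (by simp [hi, hiS]), mul_zero]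
    · simp
  exact hM (h₁.symm.trans h₀)

end DegLE

/-! ### Markov's inequality and disjoint sign-changing blocks -/

/-- Markov's inequality at an endpoint of `[0, 1]`. -/
theorem neg_two_mul_sq_le_derivative_eval_zero {d : ℕ} {P : Polynomial ℝ} (hd : P.natDegree ≤ d)
    (hP : ∀ t ∈ Set.Icc (0 : ℝ) 1, |P.eval t| ≤ 1) :
    -(2 * (d : ℝ) ^ 2) ≤ P.derivative.eval 0 := by
  -- The reflection `x ↦ (1 - x) / 2` sends `1` to `0` and `[-1, 1]` onto `[0, 1]`. Thus `-P'(0) / 2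
  -- = Q'(1)`, which is at most `T_d'(1) = d ^ 2`.
  let Q : Polynomial ℝ := P.comp (Polynomial.C (1 / 2) - Polynomial.C (1 / 2) * Polynomial.X)
  have hQd : Q.degree ≤ d := by
    refine Polynomial.natDegree_le_iff_degree_le.mp (Polynomial.natDegree_comp_le.trans ?_)
    have : (Polynomial.C (1 / 2 : ℝ) - Polynomial.C (1 / 2) * Polynomial.X).natDegree ≤ 1 := by
      compute_degree
    nlinarith
  have hQ : ∀ x ∈ Set.Icc (-1 : ℝ) 1, |Q.eval x| ≤ 1 := by
    intro x hx
    simp only [Q, Polynomial.eval_comp, Polynomial.eval_sub, Polynomial.eval_C,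
      Polynomial.eval_mul, Polynomial.eval_X]
    exact hP _ ⟨by linarith [hx.2], by linarith [hx.1]⟩
  have h := Polynomial.Chebyshev.eval_iterate_derivative_le_of_forall_abs_le_one (k := 1)
    (le_refl (1 : ℝ)) hQd hQ
  have hT := Polynomial.Chebyshev.iterate_derivative_T_eval_one_recurrence (R := ℝ) (d : ℤ) 0
  simp only [Q, Function.iterate_one, Polynomial.derivative_comp, Polynomial.eval_mul,
    Polynomial.eval_comp, Polynomial.derivative_sub, Polynomial.derivative_C,
    Polynomial.derivative_C_mul, Polynomial.derivative_X, Polynomial.eval_sub, Polynomial.eval_C,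
    Polynomial.eval_X, Polynomial.eval_zero, Polynomial.eval_one, zero_add,
    Function.iterate_zero, id] at h hT
  norm_num at h hT
  linarith

/-- A bounded polynomial of degree `d` on the cube has at most `2 * d ^ 2` neighbours of a point
where it is maximal at which its sign is not that of the maximum. -/
theorem card_le_two_mul_sq {κ : Type*} [Fintype κ] [DecidableEq κ] {d : ℕ}
    {g : (κ → Bool) → ℝ} (hg : g ∈ degLE κ d) (hb : ∀ w, |g w| ≤ 1) (h₀ : g (fun _ => false) = 1)
    (h₁ : ∀ k, g (Pi.single k true) ≤ 0) : Fintype.card κ ≤ 2 * d ^ 2 := by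
  obtain ⟨c, hc, hg⟩ := exists_coeff_of_mem_degLE hg
  -- `P t` is the mean of `g` over independent bits equal to `1` with probability `t`. Hence `|P| ≤
  -- 1` on `[0, 1]`.
  let P : Polynomial ℝ := ∑ S, Polynomial.C (c S) * Polynomial.X ^ S.card
  have hdeg : P.natDegree ≤ d := by
    refine Polynomial.natDegree_sum_le_of_forall_le _ _ fun S _ => ?_
    by_cases hS : d < S.card
    · simp [hc S hS]
    · exact (Polynomial.natDegree_C_mul_X_pow_le _ _).trans (not_lt.mp hS)
  have heval : ∀ t, P.eval t = ∑ w : κ → Bool, (∏ k, if w k then t else 1 - t) * g w := by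
    intro t
    simp only [hg, Finset.mul_sum]
    rw [Finset.sum_comm]
    simp only [mul_left_comm _ (c _), ← Finset.mul_sum, mono_eq_prod_univ,
      ← Finset.prod_mul_distrib]
    simp only [P, Polynomial.eval_finsetSum, Polynomial.eval_mul, Polynomial.eval_C,
      Polynomial.eval_pow, Polynomial.eval_X]
    refine Finset.sum_congr rfl fun S _ => ?_
    rw [sum_prod_bool fun k b => (if b then t else 1 - t) * if k ∈ S then bit b else 1]
    congr 1
    have : ∀ k, ((if true then t else 1 - t) * (if k ∈ S then bit true else 1) +
        (if false then t else 1 - t) * (if k ∈ S then bit false else 1) : ℝ) =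
        if k ∈ S then t else 1 := by
      intro k
      split_ifs <;> simp_all [bit]
    simp [bit] at this ⊢
    simp [this, Finset.prod_ite_mem]
  have hbound : ∀ t ∈ Set.Icc (0 : ℝ) 1, |P.eval t| ≤ 1 := by
    intro t ht
    have hnn : ∀ w : κ → Bool, 0 ≤ ∏ k, (if w k then t else 1 - t) := fun w =>
      Finset.prod_nonneg fun k _ => by split_ifs <;> linarith [ht.1, ht.2]
    rw [heval]
    calc _ ≤ ∑ w : κ → Bool, |(∏ k, if w k then t else 1 - t) * g w| :=
          Finset.abs_sum_le_sum_abs _ _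
      _ ≤ ∑ w : κ → Bool, ∏ k, (if w k then t else 1 - t) := Finset.sum_le_sum fun w _ => by
          rw [abs_mul, abs_of_nonneg (hnn w)]
          exact mul_le_of_le_one_right (hnn w) (hb w)
      _ = 1 := by
          rw [sum_prod_bool fun _ b => if b then t else 1 - t]
          simp
  have hmono_single : ∀ (S : Finset κ) k, mono S (Pi.single k true) =
      (if S = ∅ then 1 else 0) + if S = {k} then 1 else 0 := by
    intro S k
    by_cases hS : S ⊆ {k}
    · rcases Finset.subset_singleton_iff.mp hS with rfl | rfl <;> simp [mono, bit]
    · obtain ⟨j, hj, hjk⟩ := Finset.not_subset.mp hS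
      have h₁ : S ≠ ∅ := by rintro rfl; simp at hj
      have h₂ : S ≠ {k} := by rintro rfl; simp at hS
      rw [if_neg h₁, if_neg h₂, mono, Finset.prod_eq_zero hj]
      · simp
      · simp [bit, Finset.mem_singleton.not.mp hjk]
  have hc₀ : c ∅ = 1 := by
    rw [← h₀, hg]
    rw [Finset.sum_eq_single ∅]
    · simp [mono]
    · intro S _ hS
      obtain ⟨j, hj⟩ := Finset.nonempty_iff_ne_empty.mpr hS
      rw [mono, Finset.prod_eq_zero hj (by simp [bit]), mul_zero]
    · simp
  -- At a unit vector `g` equals `c ∅ + c {k}`, which is nonpositive while `c ∅ = 1`.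
  have hc₁ : ∀ k, c {k} ≤ -1 := by
    intro k
    have := h₁ k
    rw [hg] at this
    simp only [hmono_single, mul_add, Finset.sum_add_distrib, mul_ite, mul_one, mul_zero,
      Finset.sum_ite_eq', Finset.mem_univ, if_true, hc₀] at this
    linarith
  have hder : P.derivative.eval 0 = ∑ k, c {k} := by
    simp only [P, Polynomial.derivative_sum, Polynomial.eval_finsetSum,
      Polynomial.derivative_C_mul_X_pow, Polynomial.eval_mul, Polynomial.eval_C,
      Polynomial.eval_pow, Polynomial.eval_X]
    symm
    refine Finset.sum_of_injOn (fun k => {k}) (by simp [Set.InjOn]) (by simp) ?_ (by simp)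
    intro S _ hS
    have : S.card ≠ 1 := by
      intro h
      obtain ⟨k, rfl⟩ := Finset.card_eq_one.mp h
      simp at hS
    rcases Nat.lt_or_gt_of_ne this with h | h
    · simp [Nat.lt_one_iff.mp h]
    · rw [zero_pow (by omega), mul_zero]
  have hM := neg_two_mul_sq_le_derivative_eval_zero hdeg hbound
  have hsum : ∑ k, c {k} ≤ ∑ _k : κ, (-1 : ℝ) := Finset.sum_le_sum fun k _ => hc₁ k
  rw [hder] at hM
  simp only [Finset.sum_const, Finset.card_univ, nsmul_eq_mul, mul_neg, mul_one] at hsum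
  have : (Fintype.card κ : ℝ) ≤ 2 * (d : ℝ) ^ 2 := by linarith
  exact_mod_cast this

/-- If `|s|` is maximal at `x`, then at most `2 * d ^ 2` disjoint blocks of variables can be
flipped so that the sign of `s` changes. -/
theorem card_blocks_le {ι : Type*} [Fintype ι] [DecidableEq ι] {d : ℕ} {s : (ι → Bool) → ℝ}
    (hs : s ∈ degLE ι d) {x : ι → Bool} (hx : s x ≠ 0) (hmax : ∀ y, |s y| ≤ |s x|)
    (F : Finset (Finset ι)) (hF : ∀ M ∈ F, ∀ N ∈ F, M ≠ N → Disjoint M N)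
    (hflip : ∀ M ∈ F, ∃ y, (∀ j, j ∉ M → y j = x j) ∧ s y * s x ≤ 0) :
    F.card ≤ 2 * d ^ 2 := by
  classical
  choose! y hy hys using hflip
  -- One new bit per block decides whether the block is taken from `y` or from `x`. Disjointness
  -- makes the chosen block unique.
  let σ : (F → Bool) → ι → Bool := fun w j =>
    if h : ∃ M : F, j ∈ M.1 then (if w h.choose then y h.choose.1 j else x j) else x j
  have hσ : ∀ (w : F → Bool) (M : F) j, j ∈ M.1 → σ w j = if w M then y M.1 j else x j := by
    intro w M j hj
    have h : ∃ M : F, j ∈ M.1 := ⟨M, hj⟩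
    have hM : h.choose = M := by
      by_contra hne
      exact Finset.disjoint_left.mp
        (hF _ h.choose.2 _ M.2 fun e => hne (Subtype.ext e)) h.choose_spec hj
    simp only [σ, dif_pos h, hM]
  have hσ' : ∀ (w : F → Bool) j, (¬ ∃ M : F, j ∈ M.1) → σ w j = x j := fun w j h => dif_neg h
  have hdeg : s ∘ σ ∈ degLE F d := by
    refine comp_mem_degLE hs fun j => ?_
    by_cases h : ∃ M : F, j ∈ M.1
    · obtain ⟨M, hM⟩ := h
      simp only [hσ _ M j hM]
      exact apply_mem_degLE (fun b => bit (if b then y M.1 j else x j)) M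
    · simp only [hσ' _ j h]
      exact const_mem_degLE _ _
  have hzero : σ (fun _ => false) = x := by
    funext j
    by_cases h : ∃ M : F, j ∈ M.1
    · obtain ⟨M, hM⟩ := h
      simp [hσ _ M j hM]
    · exact hσ' (fun _ => false) j h
  have hsingle : ∀ M : F, σ (Pi.single M true) = y M.1 := by
    intro M
    funext j
    by_cases hj : j ∈ M.1
    · simp [hσ _ M j hj]
    · rw [hy _ M.2 j hj]
      by_cases h : ∃ N : F, j ∈ N.1
      · obtain ⟨N, hN⟩ := h
        have hne : N ≠ M := by rintro rfl; exact hj hN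
        simp [hσ _ N j hN, hne]
      · exact hσ' (Pi.single M true) j h
  have hpos : 0 < |s x| := abs_pos.mpr hx
  have := card_le_two_mul_sq (g := (s x)⁻¹ • (s ∘ σ)) (Submodule.smul_mem _ _ hdeg)
    (fun w => by
      simp only [Pi.smul_apply, Function.comp_apply, smul_eq_mul, abs_mul, abs_inv]
      rw [inv_mul_le_iff₀ hpos, mul_one]
      exact hmax _)
    (by simp [hzero, hx])
    (fun M => by
      have h := hys M.1 M.2
      have h₂ : (s x)⁻¹ * s (y M.1) = s (y M.1) * s x * ((s x)⁻¹) ^ 2 := by field_simp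
      simp only [Pi.smul_apply, Function.comp_apply, smul_eq_mul, hsingle, h₂]
      exact mul_nonpos_of_nonpos_of_nonneg h (sq_nonneg _))
  simpa using this

/-! ### Lowering the degree by queries, and the decision tree -/

/-- If `|s|` is maximal at `x` and `p` vanishes wherever `s` has the sign of `s x`, then fixing
some `2 * d ^ 2 * a` variables lowers the degree `a` of `p`. -/
theorem exists_degree_lowering_set {ι : Type*} [Fintype ι] [DecidableEq ι] {a d : ℕ}
    {s p : (ι → Bool) → ℝ} (hs : s ∈ degLE ι d) (hp : p ∈ degLE ι a) {x : ι → Bool}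
    (hx : s x ≠ 0) (hmax : ∀ y, |s y| ≤ |s x|) (hps : ∀ y, p y ≠ 0 → s y * s x ≤ 0) :
    ∃ U : Finset ι, U.card ≤ 2 * d ^ 2 * a ∧
      ∀ y, (fun z => p (U.piecewise y z)) ∈ degLE ι (a - 1) := by
  classical
  -- For `a = 0` truncated subtraction gives `a - 1 = 0`, so nothing need be fixed.
  rcases Nat.eq_zero_or_pos a with rfl | ha
  · exact ⟨∅, by simp, fun y => by simpa using hp⟩
  obtain ⟨c, hc, hpc⟩ := exists_coeff_of_mem_degLE hp
  let 𝒜 : Finset (Finset (Finset ι)) := Finset.univ.filter fun F =>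
    (∀ M ∈ F, c M ≠ 0 ∧ M.card = a) ∧ ∀ M ∈ F, ∀ N ∈ F, M ≠ N → Disjoint M N
  obtain ⟨F, hF, hFmax⟩ := Finset.exists_max_image 𝒜 Finset.card ⟨∅, by simp [𝒜]⟩
  obtain ⟨hFc, hFd⟩ := (Finset.mem_filter.mp hF).2
  have hcard : F.card ≤ 2 * d ^ 2 := card_blocks_le hs hx hmax F hFd fun M hM => by
    obtain ⟨y, hy, hpy⟩ := exists_ne_zero_of_coeff_ne_zero hpc hc (hFc M hM).1 (hFc M hM).2 x
    exact ⟨y, hy, hps y hpy⟩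
  refine ⟨F.biUnion id, ?_, piecewise_comp_mem_degLE_pred hpc hc _ fun S hS hSa => ?_⟩
  · refine (Finset.card_biUnion_le_card_mul _ _ a fun M hM => (hFc M hM).2.le).trans ?_
    exact Nat.mul_le_mul_right _ hcard
  · by_contra! H
    have hdisj : ∀ M ∈ F, Disjoint S M := fun M hM => Finset.disjoint_left.mpr fun j hj hjM =>
      H j hj (Finset.mem_biUnion.mpr ⟨M, hM, hjM⟩)
    -- A member of `F` disjoint from all members is disjoint from itself, hence empty, against `0 <
    -- a`.
    have hSF : S ∉ F := fun h => by
      have : S = ∅ := by simpa using hdisj S h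
      simp [this] at hSa
      omega
    have hmem : insert S F ∈ 𝒜 := by
      refine Finset.mem_filter.mpr ⟨Finset.mem_univ _, ?_, ?_⟩
      · intro M hM
        rcases Finset.mem_insert.mp hM with rfl | hM
        · exact ⟨hS, hSa⟩
        · exact hFc M hM
      · intro M hM N hN hne
        rcases Finset.mem_insert.mp hM with hMS | hM <;>
          rcases Finset.mem_insert.mp hN with hNS | hN
        · exact absurd (hMS.trans hNS.symm) hne
        · exact hMS ▸ hdisj N hN
        · exact hNS ▸ (hdisj M hM).symm
        · exact hFd M hM N hN hne
    have := hFmax _ hmem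
    rw [Finset.card_insert_of_notMem hSF] at this
    omega

/-- Query all variables in `U`, then continue with a tree for the restricted function. -/
theorem exists_tree_of_piecewise {n m : ℕ} (U : Finset (Fin n)) (f : BoolFn n)
    (h : ∀ y, ∃ t : DecisionTree n, t.Computes (fun x => f (U.piecewise y x)) ∧ t.depth ≤ m) :
    ∃ t : DecisionTree n, t.Computes f ∧ t.depth ≤ U.card + m := by
  induction U using Finset.induction_on generalizing f with
  | empty => simpa using h fun _ => false
  | insert i U hi ih =>
    have key : ∀ b, ∃ t : DecisionTree n,
        t.Computes (fun x => f (Function.update x i b)) ∧ t.depth ≤ U.card + m := by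
      refine fun b => ih _ fun y => ?_
      obtain ⟨t, ht, htm⟩ := h (Function.update y i b)
      refine ⟨t, fun x => (ht x).trans ?_, htm⟩
      beta_reduce
      rw [Finset.piecewise_insert, Function.update_self]
      congr 2
      refine Finset.piecewise_congr _ (fun j hj => ?_) fun _ _ => rfl
      exact Function.update_of_ne (ne_of_mem_of_not_mem hj hi) _ _
    obtain ⟨t₀, h₀, hd₀⟩ := key false
    obtain ⟨t₁, h₁, hd₁⟩ := key true
    refine ⟨.query i t₀ t₁, fun x => ?_, ?_⟩
    · cases hx : x i
      · simp only [DecisionTree.eval, hx, h₀ x]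
        simp [← hx]
      · simp only [DecisionTree.eval, hx, h₁ x]
        simp [← hx]
    · rw [Finset.card_insert_of_notMem hi, DecisionTree.depth]
      omega

theorem exists_tree_of_const {n : ℕ} {f : BoolFn n} (h : ∀ x y, f x = f y) (m : ℕ) :
    ∃ t : DecisionTree n, t.Computes f ∧ t.depth ≤ m :=
  ⟨.leaf (f fun _ => false), fun _ => h _ _, Nat.zero_le m⟩

/-- A decision tree from a sign representation `s` and nondeterministic representations `p` and
`q` of `f` and of its negation. -/
theorem exists_tree {n d : ℕ} (N a b : ℕ) (hN : a + b = N) (f : BoolFn n)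
    (s p q : (Fin n → Bool) → ℝ) (hs : s ∈ degLE (Fin n) d) (hp : p ∈ degLE (Fin n) a)
    (hq : q ∈ degLE (Fin n) b) (hs₀ : ∀ x, s x ≠ 0) (hsf : ∀ x, s x < 0 ↔ f x = true)
    (hpf : ∀ x, p x ≠ 0 ↔ f x = true) (hqf : ∀ x, q x ≠ 0 ↔ f x = false) :
    ∃ t : DecisionTree n, t.Computes f ∧ t.depth ≤ 2 * d ^ 2 * (a ^ 2 + b ^ 2) := by
  induction N generalizing a b f s p q with
  | zero =>
    obtain rfl : a = 0 := by omega
    refine exists_tree_of_const (fun x y => Bool.eq_iff_iff.mpr ?_) _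
    rw [← hpf, ← hpf, eq_of_mem_degLE_zero hp x y]
  | succ N ih =>
    rcases Nat.eq_zero_or_pos a with rfl | ha
    · refine exists_tree_of_const (fun x y => Bool.eq_iff_iff.mpr ?_) _
      rw [← hpf, ← hpf, eq_of_mem_degLE_zero hp x y]
    rcases Nat.eq_zero_or_pos b with rfl | hb
    · refine exists_tree_of_const (fun x y => Bool.eq_iff_iff.mpr ?_) _
      rw [← not_iff_not, Bool.not_eq_true, Bool.not_eq_true, ← hqf, ← hqf,
        eq_of_mem_degLE_zero hq x y]
    obtain ⟨x, hx⟩ := Finite.exists_max fun x => |s x|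
    -- One round pays for itself because `a ≤ a ^ 2 - (a - 1) ^ 2 = 2 * a - 1` when `a ≥ 1`.
    have arith : ∀ a b : ℕ, 0 < a → 2 * d ^ 2 * a + 2 * d ^ 2 * ((a - 1) ^ 2 + b ^ 2) ≤
        2 * d ^ 2 * (a ^ 2 + b ^ 2) := by
      intro a b ha
      obtain ⟨a, rfl⟩ := Nat.exists_eq_add_of_lt ha
      rw [← mul_add]
      refine Nat.mul_le_mul_left _ ?_
      simp only [zero_add, Nat.add_sub_cancel]
      nlinarith
    have hpos : ∀ y, f y = false → 0 < s y := fun y hy =>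
      lt_of_le_of_ne (not_lt.mp fun h => by simp [(hsf y).mp h] at hy) (hs₀ y).symm
    cases hfx : f x with
    | false =>
      obtain ⟨U, hU, hUp⟩ := exists_degree_lowering_set hs hp (hs₀ x) hx fun y hy =>
        (mul_neg_of_neg_of_pos ((hsf y).mpr ((hpf y).mp hy)) (hpos x hfx)).le
      obtain ⟨t, ht, htd⟩ := exists_tree_of_piecewise U f fun y =>
        ih (a - 1) b (by omega) (fun x => f (U.piecewise y x)) (fun x => s (U.piecewise y x))
          (fun x => p (U.piecewise y x)) (fun x => q (U.piecewise y x))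
          (piecewise_comp_mem_degLE hs U y) (hUp y) (piecewise_comp_mem_degLE hq U y)
          (fun _ => hs₀ _) (fun _ => hsf _) (fun _ => hpf _) (fun _ => hqf _)
      exact ⟨t, ht, htd.trans ((Nat.add_le_add_right hU _).trans (arith a b ha))⟩
    | true =>
      obtain ⟨U, hU, hUq⟩ := exists_degree_lowering_set hs hq (hs₀ x) hx fun y hy =>
        (mul_neg_of_pos_of_neg (hpos y ((hqf y).mp hy)) ((hsf x).mpr hfx)).le
      obtain ⟨t, ht, htd⟩ := exists_tree_of_piecewise U f fun y =>
        ih a (b - 1) (by omega) (fun x => f (U.piecewise y x)) (fun x => s (U.piecewise y x))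
          (fun x => p (U.piecewise y x)) (fun x => q (U.piecewise y x))
          (piecewise_comp_mem_degLE hs U y) (piecewise_comp_mem_degLE hp U y) (hUq y)
          (fun _ => hs₀ _) (fun _ => hsf _) (fun _ => hpf _) (fun _ => hqf _)
      refine ⟨t, ht, htd.trans ((Nat.add_le_add_right hU _).trans ?_)⟩
      rw [add_comm (a ^ 2), add_comm (a ^ 2)]
      exact arith b a hb

/-! ### From polynomials to functions and back; the inequalities -/

/-- A positive power of a bit is a function of that bit alone, so it costs degree one whatever the
exponent. -/
theorem cubeEval_mem_degLE {n d : ℕ} {p : MvPolynomial (Fin n) ℝ} (hp : p.totalDegree ≤ d) :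
    cubeEval p ∈ degLE (Fin n) d := by
  have h : cubeEval p =
      ∑ m ∈ p.support, p.coeff m • fun x => ∏ i ∈ m.support, bit (x i) ^ m i := by
    funext x
    simp [cubeEval, eval_eq]
  rw [h]
  refine Submodule.sum_mem _ fun m hm => Submodule.smul_mem _ _ ?_
  refine degLE_mono ((le_totalDegree hm).trans hp) ?_
  refine prod_mem_degLE _ (fun i x => bit (x i) ^ m i) _ fun i hi => ?_
  refine degLE_mono (Nat.one_le_iff_ne_zero.mpr (Finsupp.mem_support_iff.mp hi)) ?_
  exact apply_mem_degLE (fun b => bit b ^ m i) i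

theorem exists_multilinear_of_mem_degLE {n d : ℕ} {g : (Fin n → Bool) → ℝ}
    (hg : g ∈ degLE (Fin n) d) :
    ∃ p : MvPolynomial (Fin n) ℝ,
      IsMultilinear p ∧ (∀ x, cubeEval p x = g x) ∧ p.totalDegree ≤ d := by
  classical
  obtain ⟨c, hc, hg⟩ := exists_coeff_of_mem_degLE hg
  refine ⟨∑ S, C (c S) * ∏ i ∈ S, X i, fun i => ?_, fun x => ?_, ?_⟩
  · refine (degreeOf_sum_le i _ _).trans (Finset.sup_le fun S _ => ?_)
    refine (degreeOf_C_mul_le _ i _).trans ((degreeOf_prod_le i _ _).trans ?_)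
    have hX : ∀ j, degreeOf i (X j : MvPolynomial (Fin n) ℝ) = if i = j then 1 else 0 :=
      fun j => degreeOf_X i j
    simp only [hX, Finset.sum_ite_eq]
    split_ifs <;> simp
  · simp [cubeEval, hg, mono]
  · refine totalDegree_finsetSum_le fun S _ => ?_
    by_cases hS : d < S.card
    · simp [hc S hS]
    · refine (totalDegree_mul _ _).trans ?_
      rw [totalDegree_C, zero_add]
      refine (totalDegree_finsetProd _ _).trans ?_
      simpa using hS

theorem DecisionTree.eval_mem_degLE {n : ℕ} (t : DecisionTree n) :
    (fun x => bit (t.eval x)) ∈ degLE (Fin n) t.depth := by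
  induction t with
  | leaf b => exact const_mem_degLE (bit b) 0
  | query i t₀ t₁ h₀ h₁ =>
    have h : (fun x => bit ((query i t₀ t₁).eval x)) =
        (fun x => bit (!x i)) * (fun x => bit (t₀.eval x)) +
          (fun x => bit (x i)) * fun x => bit (t₁.eval x) := by
      funext x
      cases hx : x i <;> simp [DecisionTree.eval, hx, bit]
    rw [h]
    refine Submodule.add_mem _ ?_ ?_
    · exact degLE_mono (Nat.add_le_add_left (le_max_left _ _) 1)
        (mul_mem_degLE (apply_mem_degLE (fun b => bit (!b)) i) h₀)
    · exact degLE_mono (Nat.add_le_add_left (le_max_right _ _) 1)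
        (mul_mem_degLE (bit_mem_degLE i) h₁)

theorem deg_le_D {n : ℕ} (f : BoolFn n) : deg f ≤ D f := by
  obtain ⟨t, ht, hD⟩ := D_attained f
  have hmem := t.eval_mem_degLE
  simp only [ht _] at hmem
  obtain ⟨p, hp, hpe, hpd⟩ := exists_multilinear_of_mem_degLE hmem
  obtain ⟨hr, hre⟩ := multilinearRep_spec fun x => bit (f x)
  rw [deg, hD, multilinear_ext hr hp fun x => by rw [hre, hpe]]
  exact hpd

/-- On the cube `p = f * q`, so `q * (q - 2 * p) = q ^ 2 * (1 - 2 * f)` has the required sign. -/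
theorem sdeg_le_two_mul_rdeg {n : ℕ} (f : BoolFn n) : sdeg f ≤ 2 * rdeg f := by
  obtain ⟨p, q, ⟨-, -, h⟩, hr⟩ := rdeg_attained f
  have hp : cubeEval p ∈ degLE (Fin n) (rdeg f) := cubeEval_mem_degLE (hr ▸ le_max_left _ _)
  have hq : cubeEval q ∈ degLE (Fin n) (rdeg f) := cubeEval_mem_degLE (hr ▸ le_max_right _ _)
  obtain ⟨s, hs, hse, hsd⟩ := exists_multilinear_of_mem_degLE
    (mul_mem_degLE hq (Submodule.sub_mem _ hq (Submodule.smul_mem _ 2 hp)))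
  rw [two_mul]
  refine le_trans (Nat.sInf_le ⟨s, ⟨hs, fun x => ?_⟩, rfl⟩) hsd
  obtain ⟨hq₀, hpq⟩ := h x
  rw [div_eq_iff hq₀] at hpq
  have hsq : 0 < cubeEval q x * cubeEval q x := mul_self_pos.mpr hq₀
  rw [hse]
  simp only [Pi.mul_apply, Pi.sub_apply, Pi.smul_apply, smul_eq_mul, hpq]
  cases hf : f x
  · simpa [bit, hq₀] using hsq.le
  · have : cubeEval q x * (cubeEval q x - 2 * (bit true * cubeEval q x)) =
        -(cubeEval q x * cubeEval q x) := by
      simp only [bit, if_true]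
      ring
    rw [this]
    exact ⟨neg_ne_zero.mpr hsq.ne', iff_of_true (neg_neg_of_pos hsq) rfl⟩

theorem D_le_sdeg_sq_mul_rdeg_sq {n : ℕ} (f : BoolFn n) :
    D f ≤ 4 * sdeg f ^ 2 * rdeg f ^ 2 := by
  obtain ⟨p, q, ⟨-, -, h⟩, hr⟩ := rdeg_attained f
  obtain ⟨s, ⟨-, hs⟩, hsd⟩ := sdeg_attained f
  have hp : cubeEval p ∈ degLE (Fin n) (rdeg f) := cubeEval_mem_degLE (hr ▸ le_max_left _ _)
  have hq : cubeEval q ∈ degLE (Fin n) (rdeg f) := cubeEval_mem_degLE (hr ▸ le_max_right _ _)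
  have hval : ∀ x, cubeEval p x = bit (f x) * cubeEval q x := fun x =>
    (div_eq_iff (h x).1).mp (h x).2
  -- With `a = b = rdeg f` the depth bound is `2 * sdeg f ^ 2 * (2 * rdeg f ^ 2)`.
  obtain ⟨t, ht, htd⟩ := exists_tree _ _ _ rfl f (cubeEval s) (cubeEval p)
    (cubeEval q - cubeEval p) (cubeEval_mem_degLE hsd.ge) hp (Submodule.sub_mem _ hq hp)
    (fun x => (hs x).1) (fun x => (hs x).2)
    (fun x => by
      have := (h x).1
      rw [hval]
      cases f x <;> simp [bit, this])
    (fun x => by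
      have := (h x).1
      rw [Pi.sub_apply, hval]
      cases f x <;> simp [bit, this])
  refine (show D f ≤ t.depth from Nat.sInf_le ⟨t, ht, rfl⟩).trans (htd.trans (le_of_eq ?_))
  ring

end BooleanFunction

theorem mainTheorem2 (n : ℕ) (f : BooleanFunction.BoolFn n) :
    BooleanFunction.deg f ≤ BooleanFunction.D f ∧
    BooleanFunction.D f ≤ 4 * BooleanFunction.sdeg f ^ 2 * BooleanFunction.rdeg f ^ 2 ∧
    4 * BooleanFunction.sdeg f ^ 2 * BooleanFunction.rdeg f ^ 2 ≤
      16 * BooleanFunction.rdeg f ^ 4 := by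
  refine ⟨BooleanFunction.deg_le_D f, BooleanFunction.D_le_sdeg_sq_mul_rdeg_sq f, ?_⟩
  calc 4 * BooleanFunction.sdeg f ^ 2 * BooleanFunction.rdeg f ^ 2
      ≤ 4 * (2 * BooleanFunction.rdeg f) ^ 2 * BooleanFunction.rdeg f ^ 2 := by
        gcongr
        exact BooleanFunction.sdeg_le_two_mul_rdeg f
    _ = 16 * BooleanFunction.rdeg f ^ 4 := by ring
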